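/- Let $m\in\mathbb N$, let $C\in\mathbb R^{1\times m}$ with $C\neq 0$, let $\mu>0$, and let $\|\cdot\|$ be the Euclidean norm. Let $\theta_c$ be the supremum of the $\theta\ge 0$ that satisfy $$\theta^3-\theta^2\,(2\|C\|+1)+\theta\,(\|C\|^2+2\|C\|+\mu)-\|C\|^2<0,$$ and put $$\Omega_c=\{(\tilde C,u,\bar e_x)\in\mathbb R^{1\times m}\times\mathbb R^m\times\mathbb R:\ \|\tilde C\|\le\min\{\mu,\theta_c\}\}.$$ For $\gamma,\eta,k_P>0$ and a continuous signal $\delta q:[0,\infty)\to\mathbb R^m$, consider the noise-free human motor learning model with exogenous input $\delta q$, $$\dot{\tilde C}=-\gamma\,\tilde C\,\delta q\,\delta q^\top,\qquad \dot u=-\eta\big((\hat C^\top\hat C+\mu I)u-\hat C^\top\bar e_x\big),\qquad \dot{\bar e}_x=-k_P\,C u,\qquad \hat C=C+\tilde C .$$ Here $\tilde C=\hat C-C$ is the error of the forward-model estimate $\hat C$, $u$ is the joint velocity, and $\bar e_x=k_P e_x$ is the scaled reaching error. The signal $\delta q$ is called persistently exciting with constants $\alpha_0>0$, $\alpha_1$,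 $T>0$ if $\alpha_0 I\preceq\frac1T\int_t^{t+T}\delta q(\tau)\,\delta q(\tau)^\top d\tau\preceq\alpha_1 I$ for all $t\ge 0$. Then for all $\alpha_0,\alpha_1,T$ there is $\varepsilon^*>0$ such that, for all $\gamma,\eta,k_P>0$ with $\gamma^2/(\eta k_P)\in(0,\varepsilon^*)$: 1. for every $\delta q$ that is persistently exciting with constants $\alpha_0,\alpha_1,T$, the set $\Omega_c$ is positively invariant, that is, a trajectory that lies in $\Omega_c$ at a time $t_0\ge 0$ remains in $\Omega_c$ at all later times; 2. there are $K,\lambda>0$ such that for every such $\delta q$, every $t_0\ge0$ and every trajectory $x=(\tilde C,u,\bar e_x)$ on $[t_0,\infty)$ with $x(t_0)\in\Omega_c$, $$\|x(t)\|\le K e^{-\lambda(t-t_0)}\,\|x(t_0)\|\qquad\text{for all } t\ge t_0,$$ where $\|x\|=\max\{\|\tilde C\|,\|u\|,|\bar e_x|\}$; that is, the trajectories starting in $\Omega_c$ converge exponentially to the origin. -/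

import Mathlib

open Set
open scoped RealInnerProductSpace

namespace HML

/-- Joint space `ℝᵐ` with the Euclidean norm. A row vector `A ∈ ℝ^{1×m}` is represented by the
vector `Aᵀ` of `ℝᵐ`: thus `A v = ⟪A, v⟫`, `(A v) vᵀ` becomes `⟪A, v⟫ • v`, `Aᵀ A v` becomes
`⟪A, v⟫ • A`, and the norms agree. -/
abbrev Vec (m : ℕ) : Type := EuclideanSpace ℝ (Fin m)

/-- States `(C̃, u, ē)` of the model, `ℝ^{1×m} × ℝᵐ × ℝ`: the parameter error `C̃ = Ĉ - C`,
the joint velocity `u`, and the scaled reaching error `ē = k_P e`. -/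
abbrev State (m : ℕ) : Type := Vec m × Vec m × ℝ

/-- Forward learning: `f(C̃) = - C̃ δq δqᵀ`. -/
noncomputable def f {m : ℕ} (q Ct : Vec m) : Vec m := -(⟪Ct, q⟫ • q)

/-- Inverse learning: `g₁(u, ē, Ĉ) = - ((Ĉᵀ Ĉ + μ I) u - Ĉᵀ ē)`. -/
noncomputable def g₁ {m : ℕ} (μ : ℝ) (u : Vec m) (e : ℝ) (Chat : Vec m) : Vec m :=
  -((⟪Chat, u⟫ • Chat + μ • u) - e • Chat)

/-- Reaching error: `g₂(u) = - C u`. -/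
noncomputable def g₂ {m : ℕ} (C u : Vec m) : ℝ := -⟪C, u⟫

/-- The time-varying vector field of the noise-free coupled model with exogenous input `δq`:
`C̃' = γ f(C̃)`, `u' = η g₁(u, ē, C + C̃)`, `ē' = k_P g₂(u)`. -/
noncomputable def field {m : ℕ} (C : Vec m) (μ γ η kP : ℝ) (δq : ℝ → Vec m)
    (t : ℝ) (x : State m) : State m :=
  (γ • f (δq t) x.1, η • g₁ μ x.2.1 x.2.2 (C + x.1), kP * g₂ C x.2.1)

/-- `x` is a trajectory of the noise-free coupled model on the time interval `s`. -/
def IsTrajectoryOn {m : ℕ} (C : Vec m) (μ γ η kP : ℝ) (δq : ℝ → Vec m)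
    (x : ℝ → State m) (s : Set ℝ) : Prop :=
  ∀ t ∈ s, HasDerivWithinAt x (field C μ γ η kP δq t (x t)) s t

/-- `Ω` is positively invariant: a trajectory that starts in `Ω` at a time `t₀ ≥ 0` stays in `Ω`
for as long as it is defined. -/
def PositivelyInvariant {m : ℕ} (C : Vec m) (μ γ η kP : ℝ) (δq : ℝ → Vec m)
    (Ω : Set (State m)) : Prop :=
  ∀ t₀ t₁ : ℝ, 0 ≤ t₀ → ∀ x : ℝ → State m,
    IsTrajectoryOn C μ γ η kP δq x (Icc t₀ t₁) → x t₀ ∈ Ω → ∀ t ∈ Icc t₀ t₁, x t ∈ Ω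

/-- Persistency of excitation of a continuous signal on `[0, ∞)`, with window `T`, level `α₀` and
upper bound `α₁`: for all `t ≥ 0`, in the order of symmetric matrices,
`α₀ I ≤ (1/T) ∫_t^{t+T} δq δqᵀ ≤ α₁ I`. -/
def PersistentlyExciting {m : ℕ} (α₀ α₁ T : ℝ) (δq : ℝ → Vec m) : Prop :=
  ContinuousOn δq (Ici 0) ∧ 0 < T ∧ 0 < α₀ ∧
    ∀ t : ℝ, 0 ≤ t → ∀ v : Vec m,
      α₀ * ‖v‖ ^ 2 ≤ (1 / T) * ∫ τ in t..(t + T), ⟪v, δq τ⟫ ^ 2 ∧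
        (1 / T) * ∫ τ in t..(t + T), ⟪v, δq τ⟫ ^ 2 ≤ α₁ * ‖v‖ ^ 2

/-- The nonnegative solutions `θ` of the cubic inequality
`θ³ - θ² (2‖C‖ + 1) + θ (‖C‖² + 2‖C‖ + μ) - ‖C‖² < 0`. -/
def cubicSet {m : ℕ} (C : Vec m) (μ : ℝ) : Set ℝ :=
  {θ | 0 ≤ θ ∧
    θ ^ 3 - θ ^ 2 * (2 * ‖C‖ + 1) + θ * (‖C‖ ^ 2 + 2 * ‖C‖ + μ) - ‖C‖ ^ 2 < 0}

/-- `θ_c`. The inequality being strict, the largest solution is to be read as a supremum. -/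
noncomputable def thetaC {m : ℕ} (C : Vec m) (μ : ℝ) : ℝ := sSup (cubicSet C μ)

/-- For `C ≠ 0` and `μ > 0` the supremum is a genuine one. -/
theorem isLUB_thetaC {m : ℕ} {C : Vec m} (hC : C ≠ 0) {μ : ℝ} (hμ : 0 < μ) :
    IsLUB (cubicSet C μ) (thetaC C μ) := by
  have hn : 0 < ‖C‖ := norm_pos_iff.mpr hC
  refine isLUB_csSup ⟨0, le_refl _, ?_⟩ ⟨1, ?_⟩
  · have : 0 < ‖C‖ ^ 2 := by positivity
    norm_num
    exact this
  · rintro θ ⟨h0, h⟩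
    by_contra! h1
    have : 0 ≤ (θ - ‖C‖) ^ 2 * (θ - 1) :=
      mul_nonneg (sq_nonneg _) (by linarith)
    have h2 : 0 < θ * μ := mul_pos (by linarith) hμ
    nlinarith

/-- `Ω_c = {(C̃, u, ē) | ‖C̃‖ ≤ min {μ, θ_c}}`. -/
def OmegaC {m : ℕ} (C : Vec m) (μ : ℝ) : Set (State m) :=
  {x | ‖x.1‖ ≤ min μ (thetaC C μ)}

end HML

namespace HML

open MeasureTheory

variable {m : ℕ}

/-! The system is a cascade: `C̃` evolves independently of `(u, ē)`. Its squared norm has derivative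
`-2γ⟪C̃, δq⟫²`, so balls in `C̃` are invariant, and persistent excitation turns this into uniform
exponential decay (`window_decay`, `exists_exp_decay_parameter`). Given `C̃`, the pair `(u, ē)`
obeys a linear system that is exponentially stable at `C̃ = 0`. A quadratic Lyapunov function with a
small cross term (`exists_lyap`) decays at rate `-a + b‖C̃‖`; the perturbation is integrable in
time, so it costs only a constant factor (`gronwall_exp_perturbation`). -/

lemma antitoneOn_of_hasDerivWithinAt {g g' : ℝ → ℝ} {s : Set ℝ} (hs : Convex ℝ s)
    (h : ∀ t ∈ s, HasDerivWithinAt g (g' t) s t) (h0 : ∀ t ∈ s, g' t ≤ 0) : AntitoneOn g s :=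
  antitoneOn_of_hasDerivWithinAt_nonpos hs (fun t ht => (h t ht).continuousWithinAt)
    (fun t ht => (h t (interior_subset ht)).mono interior_subset)
    (fun t ht => h0 t (interior_subset ht))

/-! ### Exponential decay of the parameter error -/

section Parameter

variable {γ : ℝ} {q z : ℝ → Vec m} {s : Set ℝ}

lemma hasDerivWithinAt_norm_sq_parameter {t : ℝ}
    (hz : HasDerivWithinAt z (γ • f (q t) (z t)) s t) :
    HasDerivWithinAt (fun t => ‖z t‖ ^ 2) (-(2 * γ) * ⟪z t, q t⟫ ^ 2) s t := by
  convert hz.norm_sq using 1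
  simp only [f, smul_neg, inner_neg_right, inner_smul_right]
  ring

lemma antitoneOn_norm_parameter (hγ : 0 < γ) (hs : Convex ℝ s)
    (hz : ∀ t ∈ s, HasDerivWithinAt z (γ • f (q t) (z t)) s t) :
    AntitoneOn (fun t => ‖z t‖) s := by
  have h := antitoneOn_of_hasDerivWithinAt hs
    (fun t ht => hasDerivWithinAt_norm_sq_parameter (hz t ht))
    (fun t _ => by nlinarith [sq_nonneg ⟪z t, q t⟫])
  intro a ha b hb hab
  exact (sq_le_sq₀ (norm_nonneg _) (norm_nonneg _)).1 (h ha hb hab)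

end Parameter

/-- Trace of the upper excitation bound: sum it over an orthonormal basis. -/
lemma PersistentlyExciting.integral_norm_sq_le {α₀ α₁ T : ℝ} {q : ℝ → Vec m}
    (hq : PersistentlyExciting α₀ α₁ T q) {t : ℝ} (ht : 0 ≤ t) :
    ∫ τ in t..(t + T), ‖q τ‖ ^ 2 ≤ m * α₁ * T := by
  obtain ⟨hc, hT, -, h⟩ := hq
  have hle : t ≤ t + T := by linarith
  have hcI : ContinuousOn q (uIcc t (t + T)) := by
    rw [uIcc_of_le hle]
    exact hc.mono fun x hx => ht.trans hx.1
  have hsum : ∀ τ, ‖q τ‖ ^ 2 = ∑ i, ⟪EuclideanSpace.basisFun (Fin m) ℝ i, q τ⟫ ^ 2 := fun τ => by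
    simp [EuclideanSpace.norm_sq_eq, EuclideanSpace.inner_single_left]
  simp only [hsum]
  rw [intervalIntegral.integral_finsetSum]
  · calc _ ≤ ∑ _i : Fin m, α₁ * T := by
          refine Finset.sum_le_sum fun i _ => ?_
          have := (h t ht (EuclideanSpace.basisFun (Fin m) ℝ i)).2
          rw [(EuclideanSpace.basisFun (Fin m) ℝ).norm_eq_one, one_div,
            inv_mul_le_iff₀ hT] at this
          linarith
      _ = m * α₁ * T := by simp; ring
  · intro i _
    exact ((continuousOn_const.inner hcI).pow 2).intervalIntegrable

/-- Over one excitation window the squared parameter error drops by a fixed fraction. -/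
lemma window_decay {γ α₀ α₁ T : ℝ} (hγ : 0 < γ) {q z : ℝ → Vec m}
    (hq : PersistentlyExciting α₀ α₁ T q) {s : ℝ} (hs : 0 ≤ s)
    (hz : ∀ t ∈ Icc s (s + T), HasDerivWithinAt z (γ • f (q t) (z t)) (Icc s (s + T)) t) :
    α₀ * T * ‖z s‖ ^ 2 * γ
      ≤ (1 + γ ^ 2 * (m * α₁ * T) ^ 2) * (‖z s‖ ^ 2 - ‖z (s + T)‖ ^ 2) := by
  have hM := hq.integral_norm_sq_le hs
  obtain ⟨hc, hT, -, hpe⟩ := hq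
  set M := m * α₁ * T
  have hle : s ≤ s + T := by linarith
  have hqc : ContinuousOn q (Icc s (s + T)) := hc.mono fun x hx => hs.trans hx.1
  have hzc : ContinuousOn z (Icc s (s + T)) := fun t ht => (hz t ht).continuousWithinAt
  have hint : ∀ {g : ℝ → ℝ} {b : ℝ}, b ∈ Icc s (s + T) → ContinuousOn g (Icc s (s + T)) →
      IntervalIntegrable g volume s b := fun hb hg => by
    refine ContinuousOn.intervalIntegrable (hg.mono ?_)
    rw [uIcc_of_le hb.1]
    exact Icc_subset_Icc_right hb.2
  have hT_mem : s + T ∈ Icc s (s + T) := right_mem_Icc.2 hle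
  have ha : ContinuousOn (fun τ => ⟪z τ, q τ⟫) (Icc s (s + T)) := hzc.inner hqc
  have hM0 : 0 ≤ M := le_trans (intervalIntegral.integral_nonneg hle fun _ _ => by positivity) hM
  set D := ∫ τ in s..(s + T), ⟪z τ, q τ⟫ ^ 2 with hD
  have hD0 : 0 ≤ D := intervalIntegral.integral_nonneg hle fun _ _ => by positivity
  have hlin : ∀ c d : ℝ, ∫ τ in s..(s + T), (c * ⟪z τ, q τ⟫ ^ 2 + d * ‖q τ‖ ^ 2) =
      c * D + d * ∫ τ in s..(s + T), ‖q τ‖ ^ 2 := fun c d => by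
    rw [hD, ← intervalIntegral.integral_const_mul, ← intervalIntegral.integral_const_mul]
    exact intervalIntegral.integral_add (hint hT_mem (continuousOn_const.mul (ha.pow 2)))
      (hint hT_mem (continuousOn_const.mul (hqc.norm.pow 2)))
  have hdrop : ‖z s‖ ^ 2 - ‖z (s + T)‖ ^ 2 = 2 * γ * D := by
    have := intervalIntegral.integral_eq_sub_of_hasDerivAt_of_le hle
      (f := fun t => ‖z t‖ ^ 2) (f' := fun t => -(2 * γ) * ⟪z t, q t⟫ ^ 2)
      (hzc.norm.pow 2)
      (fun t ht => (hasDerivWithinAt_norm_sq_parameter (hz t (Ioo_subset_Icc_self ht))).hasDerivAt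
        (Icc_mem_nhds ht.1 ht.2))
      (hint hT_mem (continuousOn_const.mul (ha.pow 2)))
    rw [intervalIntegral.integral_const_mul] at this
    linarith
  -- Cauchy–Schwarz for `γ ∫ |⟪z, q⟫| ‖q‖`, derived below from the discriminant of a nonnegative
  -- quadratic in `x`.
  have hdev : ∀ τ ∈ Icc s (s + T), ‖z s - z τ‖ ^ 2 ≤ γ ^ 2 * (D * M) := by
    intro τ hτ
    have hsub : Icc s τ ⊆ Icc s (s + T) := Icc_subset_Icc_right hτ.2
    have hfc : ContinuousOn (fun t => γ • f (q t) (z t)) (Icc s τ) := by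
      have : ContinuousOn (fun t => γ • f (q t) (z t)) (Icc s (s + T)) :=
        (ha.smul hqc).neg.const_smul γ
      exact this.mono hsub
    have hftc : ∫ t in s..τ, γ • f (q t) (z t) = z τ - z s :=
      intervalIntegral.integral_eq_sub_of_hasDerivAt_of_le hτ.1 (hzc.mono hsub)
        (fun t ht => (hz t (hsub (Ioo_subset_Icc_self ht))).hasDerivAt
          (Icc_mem_nhds ht.1 (ht.2.trans_le hτ.2)))
        (by rw [← uIcc_of_le hτ.1] at hfc; exact hfc.intervalIntegrable)
    have hnorm : ‖z s - z τ‖ ≤ ∫ t in s..τ, γ * (|⟪z t, q t⟫| * ‖q t‖) := by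
      rw [norm_sub_rev, ← hftc]
      refine (intervalIntegral.norm_integral_le_integral_norm hτ.1).trans_eq ?_
      refine intervalIntegral.integral_congr fun t _ => ?_
      simp [f, norm_smul, abs_of_pos hγ]
    have hquad : ∀ x : ℝ, 0 ≤ γ ^ 2 * D * (x * x) + (-(2 * ‖z s - z τ‖)) * x + M := by
      intro x
      have hx : 2 * x * ‖z s - z τ‖ ≤ γ ^ 2 * D * (x * x) + M := by
        rcases le_total x 0 with hx | hx
        · have : 0 ≤ γ ^ 2 * D * (x * x) := mul_nonneg (by positivity) (mul_self_nonneg x)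
          nlinarith [norm_nonneg (z s - z τ)]
        have h1 : ∫ t in s..τ, 2 * x * (γ * (|⟪z t, q t⟫| * ‖q t‖)) ≤
            ∫ t in s..τ, (γ ^ 2 * (x * x) * ⟪z t, q t⟫ ^ 2 + 1 * ‖q t‖ ^ 2) := by
          refine intervalIntegral.integral_mono_on hτ.1
            (hint hτ (continuousOn_const.mul (continuousOn_const.mul (ha.abs.mul hqc.norm))))
            (hint hτ ((continuousOn_const.mul (ha.pow 2)).add
              (continuousOn_const.mul (hqc.norm.pow 2)))) fun t _ => ?_
          rw [← sq_abs ⟪z t, q t⟫]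
          nlinarith [sq_nonneg (γ * x * |⟪z t, q t⟫| - ‖q t‖)]
        have h2 : ∫ t in s..τ, (γ ^ 2 * (x * x) * ⟪z t, q t⟫ ^ 2 + 1 * ‖q t‖ ^ 2) ≤
            ∫ t in s..(s + T), (γ ^ 2 * (x * x) * ⟪z t, q t⟫ ^ 2 + 1 * ‖q t‖ ^ 2) := by
          refine intervalIntegral.integral_mono_interval le_rfl hτ.1 hτ.2 ?_
            (hint hT_mem ((continuousOn_const.mul (ha.pow 2)).add
              (continuousOn_const.mul (hqc.norm.pow 2))))
          exact Filter.Eventually.of_forall fun t => by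
            have := mul_self_nonneg x
            show (0 : ℝ) ≤ _
            positivity
        rw [intervalIntegral.integral_const_mul] at h1
        rw [hlin] at h2
        nlinarith
      linarith
    have := discrim_le_zero hquad
    unfold discrim at this
    linarith
  have hlow : α₀ * T * ‖z s‖ ^ 2 ≤ ∫ τ in s..(s + T), ⟪z s, q τ⟫ ^ 2 := by
    have := (hpe s hs (z s)).1
    rw [one_div, le_inv_mul_iff₀ hT] at this
    linarith
  -- Excitation controls the frozen vector `z s`; replacing it by `z τ` costs the deviation `hdev`.
  have hup : ∫ τ in s..(s + T), ⟪z s, q τ⟫ ^ 2 ≤ 2 * D + 2 * (γ ^ 2 * (D * M)) * M := by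
    calc ∫ τ in s..(s + T), ⟪z s, q τ⟫ ^ 2
        ≤ ∫ τ in s..(s + T), (2 * ⟪z τ, q τ⟫ ^ 2 + 2 * (γ ^ 2 * (D * M)) * ‖q τ‖ ^ 2) := by
          refine intervalIntegral.integral_mono_on hle
            (hint hT_mem ((continuousOn_const.inner hqc).pow 2))
            (hint hT_mem ((continuousOn_const.mul (ha.pow 2)).add
              (continuousOn_const.mul (hqc.norm.pow 2)))) fun τ hτ => ?_
          have h1 : ⟪z s, q τ⟫ = ⟪z τ, q τ⟫ + ⟪z s - z τ, q τ⟫ := by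
            rw [inner_sub_left]; ring
          have h2 : ⟪z s - z τ, q τ⟫ ^ 2 ≤ ‖z s - z τ‖ ^ 2 * ‖q τ‖ ^ 2 := by
            rw [← mul_pow, ← sq_abs]
            exact pow_le_pow_left₀ (abs_nonneg _) (abs_real_inner_le_norm _ _) 2
          have h3 := mul_le_mul_of_nonneg_right (hdev τ hτ) (sq_nonneg ‖q τ‖)
          rw [h1]
          nlinarith [sq_nonneg (⟪z τ, q τ⟫ - ⟪z s - z τ, q τ⟫)]
      _ = 2 * D + 2 * (γ ^ 2 * (D * M)) * ∫ τ in s..(s + T), ‖q τ‖ ^ 2 := hlin _ _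
      _ ≤ _ := by gcongr
  rw [hdrop]
  nlinarith [mul_le_mul_of_nonneg_right (hlow.trans hup) hγ.le]

/-- Under persistent excitation the parameter error decays exponentially, uniformly in the
signal and in the initial time. -/
lemma exists_exp_decay_parameter {γ α₀ α₁ T : ℝ} (hγ : 0 < γ) (hα : 0 < α₀) (hT : 0 < T) :
    ∃ K : ℝ, 0 < K ∧ ∃ lam : ℝ, 0 < lam ∧ ∀ q : ℝ → Vec m, PersistentlyExciting α₀ α₁ T q →
      ∀ t₀ : ℝ, 0 ≤ t₀ → ∀ z : ℝ → Vec m,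
        (∀ t ∈ Ici t₀, HasDerivWithinAt z (γ • f (q t) (z t)) (Ici t₀) t) →
          ∀ t : ℝ, t₀ ≤ t → ‖z t‖ ≤ K * Real.exp (-lam * (t - t₀)) * ‖z t₀‖ := by
  set P := 1 + γ ^ 2 * (m * α₁ * T) ^ 2 with hPdef
  have hP : 0 < P := by positivity
  set ρ := α₀ * T * γ / P with hρdef
  have hρ : 0 < ρ := by positivity
  -- The square loses a factor `exp (-ρ)` per window, hence the halves; the prefactor pays for the
  -- last incomplete window.
  refine ⟨Real.exp (ρ / 2), Real.exp_pos _, ρ / 2 / T, by positivity, ?_⟩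
  intro q hq t₀ ht₀ z hz t ht
  have hanti := antitoneOn_norm_parameter hγ (convex_Ici t₀) hz
  have hstep : ∀ s, t₀ ≤ s → ‖z (s + T)‖ ^ 2 ≤ Real.exp (-ρ) * ‖z s‖ ^ 2 := by
    intro s hs
    have hsub : Icc s (s + T) ⊆ Ici t₀ := fun x hx => hs.trans hx.1
    have h := window_decay hγ hq (ht₀.trans hs) fun t ht => (hz t (hsub ht)).mono hsub
    have h1 : ρ * ‖z s‖ ^ 2 ≤ ‖z s‖ ^ 2 - ‖z (s + T)‖ ^ 2 := by
      rw [hρdef, div_mul_eq_mul_div, div_le_iff₀ hP]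
      linarith
    nlinarith [Real.add_one_le_exp (-ρ), sq_nonneg ‖z s‖]
  have hiter : ∀ n : ℕ, ‖z (t₀ + n * T)‖ ^ 2 ≤ Real.exp (-ρ * n) * ‖z t₀‖ ^ 2 := by
    intro n
    induction n with
    | zero => simp
    | succ n ih =>
      have h := hstep (t₀ + n * T) (by have : 0 ≤ (n : ℝ) * T := by positivity
                                       linarith)
      have e1 : t₀ + ((n + 1 : ℕ) : ℝ) * T = t₀ + n * T + T := by push_cast; ring
      have e2 : Real.exp (-ρ * ((n + 1 : ℕ) : ℝ)) = Real.exp (-ρ) * Real.exp (-ρ * n) := by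
        rw [← Real.exp_add]; push_cast; ring_nf
      rw [e1, e2, mul_assoc]
      exact h.trans (mul_le_mul_of_nonneg_left ih (Real.exp_pos _).le)
  set n := ⌊(t - t₀) / T⌋₊ with hn
  have hx : 0 ≤ (t - t₀) / T := div_nonneg (by linarith) hT.le
  have hn1 : (n : ℝ) * T ≤ t - t₀ := by
    rw [← le_div_iff₀ hT]
    exact Nat.floor_le hx
  have hn2 : (t - t₀) / T < n + 1 := Nat.lt_floor_add_one _
  have hnT : 0 ≤ (n : ℝ) * T := by positivity
  have h1 : ‖z t‖ ≤ ‖z (t₀ + n * T)‖ :=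
    hanti (mem_Ici.2 (by linarith)) (mem_Ici.2 ht) (by linarith)
  refine (sq_le_sq₀ (norm_nonneg _) (by positivity)).1 ?_
  calc ‖z t‖ ^ 2 ≤ ‖z (t₀ + n * T)‖ ^ 2 := by gcongr
    _ ≤ Real.exp (-ρ * n) * ‖z t₀‖ ^ 2 := hiter n
    _ ≤ Real.exp (ρ + -ρ * ((t - t₀) / T)) * ‖z t₀‖ ^ 2 := by
        gcongr
        nlinarith
    _ = _ := by
        rw [mul_pow, ← Real.exp_add, ← Real.exp_nat_mul]
        congr 2
        push_cast
        ring

/-! ### Lyapunov function of the velocity and reaching error -/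

/-- The Lyapunov function of the subsystem of `(u, ē)`. -/
noncomputable def lyap (C : Vec m) (η kP δ : ℝ) (u : Vec m) (e : ℝ) : ℝ :=
  ‖u‖ ^ 2 / η + e ^ 2 / kP - 2 * δ * (e * ⟪C, u⟫)

/-- The derivative of `lyap` along the subsystem of `(u, ē)` with parameter error `z`. -/
noncomputable def lyapDeriv (C : Vec m) (μ η kP δ : ℝ) (z u : Vec m) (e : ℝ) : ℝ :=
  -2 * ⟪C + z, u⟫ ^ 2 - 2 * μ * ‖u‖ ^ 2 + 2 * e * ⟪z, u⟫
    - 2 * δ * (-kP * ⟪C, u⟫ ^ 2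
      - η * e * (⟪C + z, u⟫ * ⟪C, C + z⟫ + μ * ⟪C, u⟫ - e * ⟪C, C + z⟫))

/-- The weights `1/η` and `1/kP` cancel the coupling `e⟪C, u⟫`, leaving `2e⟪z, u⟫`. The cross term
supplies the damping `-2δη e²⟪C, C + z⟫` in `e`. -/
lemma hasDerivWithinAt_lyap {C : Vec m} {μ η kP δ : ℝ} (hη : 0 < η) (hk : 0 < kP)
    {z u : ℝ → Vec m} {e : ℝ → ℝ} {s : Set ℝ} {t : ℝ}
    (hu : HasDerivWithinAt u (η • g₁ μ (u t) (e t) (C + z t)) s t)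
    (he : HasDerivWithinAt e (kP * g₂ C (u t)) s t) :
    HasDerivWithinAt (fun t => lyap C η kP δ (u t) (e t))
      (lyapDeriv C μ η kP δ (z t) (u t) (e t)) s t := by
  have h := ((hu.norm_sq.div_const η).add ((he.pow 2).div_const kP)).sub
    ((he.mul ((hasDerivWithinAt_const t s C).inner ℝ hu)).const_mul (2 * δ))
  refine HasDerivWithinAt.congr_deriv h ?_
  simp only [lyapDeriv, g₁, g₂, smul_neg, inner_neg_right, inner_smul_right, inner_add_right,
    inner_sub_right, inner_add_left, inner_zero_left, real_inner_self_eq_norm_sq,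
    real_inner_comm (u t) C, real_inner_comm (u t) (z t)]
  field_simp
  ring

/-- Young's inequality spends half of the damping in `e` on the mixed terms; `hδ1` makes the
resulting `‖u‖²` terms cost at most half of `2μ‖u‖²`. What remains is proportional to `‖z‖`. -/
lemma lyapDeriv_le {C : Vec m} {μ η kP δ : ℝ} (hη : 0 < η) (hk : 0 < kP) (hδ : 0 < δ)
    (hμ : 0 < μ)
    (hδ1 : δ * (2 * kP * ‖C‖ ^ 2 + η * ((‖C‖ + μ) ^ 2 + μ) ^ 2) ≤ μ)
    {z u : Vec m} {e : ℝ} (hz : ‖z‖ ≤ μ) :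
    lyapDeriv C μ η kP δ z u e ≤
      -(min μ (δ * η * ‖C‖ ^ 2)) * (‖u‖ ^ 2 + e ^ 2)
        + (1 + 2 * δ * η * ‖C‖) * ‖z‖ * (‖u‖ ^ 2 + e ^ 2) := by
  have hCz : ‖C + z‖ ≤ ‖C‖ + μ := (norm_add_le _ _).trans (by linarith)
  have hCu : ⟪C, u⟫ ^ 2 ≤ ‖C‖ ^ 2 * ‖u‖ ^ 2 := by
    rw [← mul_pow, ← sq_abs]
    exact pow_le_pow_left₀ (abs_nonneg _) (abs_real_inner_le_norm _ _) 2
  have h1 : e * ⟪z, u⟫ ≤ |e| * (‖z‖ * ‖u‖) := by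
    refine (le_abs_self _).trans ?_
    rw [abs_mul]
    exact mul_le_mul_of_nonneg_left (abs_real_inner_le_norm _ _) (abs_nonneg _)
  have h2 : e * (⟪C + z, u⟫ * ⟪C, C + z⟫ + μ * ⟪C, u⟫) ≤
      |e| * (‖C‖ * ‖u‖ * ((‖C‖ + μ) ^ 2 + μ)) := by
    refine (le_abs_self _).trans ?_
    rw [abs_mul]
    refine mul_le_mul_of_nonneg_left ?_ (abs_nonneg _)
    refine (abs_add_le _ _).trans ?_
    rw [abs_mul, abs_mul, abs_of_pos hμ]
    calc _ ≤ (‖C + z‖ * ‖u‖) * (‖C‖ * ‖C + z‖) + μ * (‖C‖ * ‖u‖) := by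
          gcongr <;> exact abs_real_inner_le_norm _ _
      _ ≤ ((‖C‖ + μ) * ‖u‖) * (‖C‖ * (‖C‖ + μ)) + μ * (‖C‖ * ‖u‖) := by gcongr
      _ = _ := by ring
  have h3 : -⟪C, C + z⟫ ≤ -‖C‖ ^ 2 + ‖C‖ * ‖z‖ := by
    rw [inner_add_right, real_inner_self_eq_norm_sq]
    linarith [(abs_le.1 (abs_real_inner_le_norm C z)).1]
  have h4 := mul_le_mul_of_nonneg_left h3 (by positivity : 0 ≤ 2 * δ * η * e ^ 2)
  have h2' := mul_le_mul_of_nonneg_left h2 (by positivity : 0 ≤ 2 * δ * η)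
  have hCu' := mul_le_mul_of_nonneg_left hCu (by positivity : 0 ≤ 2 * δ * kP)
  set H := (‖C‖ + μ) ^ 2 + μ
  have h5 : 2 * δ * η * (|e| * (‖C‖ * ‖u‖ * H)) ≤
      δ * η * (‖C‖ ^ 2 * e ^ 2 + H ^ 2 * ‖u‖ ^ 2) := by
    rw [← sq_abs e]
    nlinarith [mul_nonneg (mul_pos hδ hη).le (sq_nonneg (‖C‖ * |e| - H * ‖u‖))]
  have h6 : 2 * (|e| * (‖z‖ * ‖u‖)) ≤ ‖z‖ * (‖u‖ ^ 2 + e ^ 2) := by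
    rw [← sq_abs e]
    nlinarith [mul_nonneg (norm_nonneg z) (sq_nonneg (‖u‖ - |e|))]
  have h7 := mul_le_mul_of_nonneg_right hδ1 (sq_nonneg ‖u‖)
  have h8 := mul_le_mul_of_nonneg_right (min_le_left μ (δ * η * ‖C‖ ^ 2)) (sq_nonneg ‖u‖)
  have h9 := mul_le_mul_of_nonneg_right (min_le_right μ (δ * η * ‖C‖ ^ 2)) (sq_nonneg e)
  have h10 : 0 ≤ 2 * δ * η * ‖C‖ * ‖z‖ * ‖u‖ ^ 2 := by positivity
  unfold lyapDeriv
  nlinarith [sq_nonneg ⟪C + z, u⟫]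

lemma two_mul_cross_le {C : Vec m} {η kP δ : ℝ} (hη : 0 < η) (hk : 0 < kP) (hδ : 0 < δ)
    (hδ2 : δ ≤ 1 / (2 * η * (‖C‖ + 1))) (hδ3 : δ ≤ 1 / (2 * kP * (‖C‖ + 1)))
    (u : Vec m) (e : ℝ) :
    |2 * δ * (e * ⟪C, u⟫)| ≤ (‖u‖ ^ 2 / η + e ^ 2 / kP) / 2 := by
  have hc := norm_nonneg C
  have h1 : |e * ⟪C, u⟫| ≤ |e| * (‖C‖ * ‖u‖) := by
    rw [abs_mul]
    exact mul_le_mul_of_nonneg_left (abs_real_inner_le_norm _ _) (abs_nonneg _)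
  have h2 : δ * ‖C‖ ≤ 1 / η / 2 := by
    rw [le_div_iff₀ (by positivity)] at hδ2
    rw [le_div_iff₀ two_pos, le_div_iff₀ hη]
    nlinarith [mul_pos hδ hη]
  have h3 : δ * ‖C‖ ≤ 1 / kP / 2 := by
    rw [le_div_iff₀ (by positivity)] at hδ3
    rw [le_div_iff₀ two_pos, le_div_iff₀ hk]
    nlinarith [mul_pos hδ hk]
  have h4 := mul_le_mul_of_nonneg_right h2 (sq_nonneg ‖u‖)
  have h5 := mul_le_mul_of_nonneg_right h3 (sq_nonneg |e|)
  have h6 : 0 ≤ δ * ‖C‖ * (‖u‖ - |e|) ^ 2 := by positivity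
  have h7 : |2 * δ * (e * ⟪C, u⟫)| ≤ 2 * δ * (|e| * (‖C‖ * ‖u‖)) := by
    rw [abs_mul, abs_of_pos (by positivity : 0 < 2 * δ)]
    gcongr
  have h8 : (‖u‖ ^ 2 / η + e ^ 2 / kP) / 2 = 1 / η / 2 * ‖u‖ ^ 2 + 1 / kP / 2 * |e| ^ 2 := by
    rw [sq_abs]; ring
  rw [h8]
  nlinarith

/-- A quadratic Lyapunov function of the subsystem of `(u, ē)` satisfies a linear differential
inequality whose rate is perturbed by the parameter error. -/
lemma exists_lyap {C : Vec m} (hC : C ≠ 0) {μ η kP : ℝ} (hμ : 0 < μ) (hη : 0 < η) (hk : 0 < kP) :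
    ∃ δ k₁ k₂ a b : ℝ, 0 < k₁ ∧ 0 < k₂ ∧ 0 < a ∧ 0 < b ∧
      (∀ u e, k₁ * (‖u‖ ^ 2 + e ^ 2) ≤ lyap C η kP δ u e) ∧
      (∀ u e, lyap C η kP δ u e ≤ k₂ * (‖u‖ ^ 2 + e ^ 2)) ∧
      ∀ z u e, ‖z‖ ≤ μ →
        lyapDeriv C μ η kP δ z u e ≤ (-a + b * ‖z‖) * lyap C η kP δ u e := by
  have hc : 0 < ‖C‖ := norm_pos_iff.2 hC
  -- The first cap on `δ` secures decrease, the other two positive definiteness.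
  obtain ⟨δ, hδ, h1, h2, h3⟩ : ∃ δ : ℝ, 0 < δ ∧
      δ ≤ μ / (2 * kP * ‖C‖ ^ 2 + η * ((‖C‖ + μ) ^ 2 + μ) ^ 2) ∧
      δ ≤ 1 / (2 * η * (‖C‖ + 1)) ∧ δ ≤ 1 / (2 * kP * (‖C‖ + 1)) :=
    ⟨min _ (min _ _), lt_min (by positivity) (lt_min (by positivity) (by positivity)),
      min_le_left _ _, (min_le_right _ _).trans (min_le_left _ _),
      (min_le_right _ _).trans (min_le_right _ _)⟩
  rw [le_div_iff₀ (by positivity)] at h1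
  have hcross := two_mul_cross_le hη hk hδ h2 h3
  have hη' : 0 < 1 / η := by positivity
  have hk' : 0 < 1 / kP := by positivity
  set k₁ := min (1 / η) (1 / kP) / 2 with hk₁
  set k₂ := 2 * (1 / η + 1 / kP) with hk₂
  have hk₁pos : 0 < k₁ := half_pos (lt_min hη' hk')
  have hk₂pos : 0 < k₂ := by positivity
  have hform : ∀ (u : Vec m) (e : ℝ),
      ‖u‖ ^ 2 / η + e ^ 2 / kP = 1 / η * ‖u‖ ^ 2 + 1 / kP * e ^ 2 := fun u e => by ring
  have hlow : ∀ (u : Vec m) (e : ℝ), k₁ * (‖u‖ ^ 2 + e ^ 2) ≤ lyap C η kP δ u e := by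
    intro u e
    have h := (abs_le.1 (hcross u e)).2
    have h8 := mul_le_mul_of_nonneg_right (min_le_left (1 / η) (1 / kP)) (sq_nonneg ‖u‖)
    have h9 := mul_le_mul_of_nonneg_right (min_le_right (1 / η) (1 / kP)) (sq_nonneg e)
    unfold lyap
    rw [hform] at *
    rw [hk₁]
    linarith
  have hupp : ∀ (u : Vec m) (e : ℝ), lyap C η kP δ u e ≤ k₂ * (‖u‖ ^ 2 + e ^ 2) := by
    intro u e
    have h := (abs_le.1 (hcross u e)).1
    have h8 : 0 ≤ 1 / η * ‖u‖ ^ 2 := by positivity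
    have h9 : 0 ≤ 1 / kP * e ^ 2 := by positivity
    have h10 : 0 ≤ 1 / η * e ^ 2 := by positivity
    have h11 : 0 ≤ 1 / kP * ‖u‖ ^ 2 := by positivity
    unfold lyap
    rw [hform] at *
    rw [hk₂]
    linarith
  set a := min μ (δ * η * ‖C‖ ^ 2) with ha
  have ha0 : 0 < a := lt_min hμ (by positivity)
  set b := 1 + 2 * δ * η * ‖C‖ with hb
  have hb0 : 0 < b := by positivity
  refine ⟨δ, k₁, k₂, a / k₂, b / k₁, hk₁pos, hk₂pos, by positivity, by positivity,
    hlow, hupp, fun z u e hz => ?_⟩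
  have h := lyapDeriv_le hη hk hδ hμ h1 (u := u) (e := e) hz
  have e1 : a / k₂ * lyap C η kP δ u e ≤ a * (‖u‖ ^ 2 + e ^ 2) := by
    rw [div_mul_eq_mul_div, div_le_iff₀ hk₂pos]
    nlinarith [mul_le_mul_of_nonneg_left (hupp u e) ha0.le]
  have e2 : b * ‖z‖ * (‖u‖ ^ 2 + e ^ 2) ≤ b / k₁ * ‖z‖ * lyap C η kP δ u e := by
    rw [div_mul_eq_mul_div, div_mul_eq_mul_div, le_div_iff₀ hk₁pos]
    nlinarith [mul_le_mul_of_nonneg_left (hlow u e) (by positivity : 0 ≤ b * ‖z‖)]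
  rw [← ha, ← hb] at h
  linarith

/-! ### Comparison under a decaying perturbation -/

/-- A Grönwall inequality with a rate that is an exponentially decaying perturbation of `-a`. -/
lemma gronwall_exp_perturbation {W W' : ℝ → ℝ} {t₀ a B lam : ℝ} (hB : 0 ≤ B) (hlam : 0 < lam)
    (hW : ∀ t ∈ Ici t₀, HasDerivWithinAt W (W' t) (Ici t₀) t) (hW0 : ∀ t ∈ Ici t₀, 0 ≤ W t)
    (hle : ∀ t ∈ Ici t₀, W' t ≤ (-a + B * Real.exp (-lam * (t - t₀))) * W t)
    {t : ℝ} (ht : t₀ ≤ t) :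
    W t ≤ Real.exp (B / lam) * Real.exp (-a * (t - t₀)) * W t₀ := by
  -- `exp φ` is the integrating factor: `φ'` is minus the perturbed rate.
  set φ : ℝ → ℝ := fun t => a * (t - t₀) + B / lam * Real.exp (-lam * (t - t₀)) with hφ
  have hφ' : ∀ t, HasDerivAt φ (a - B * Real.exp (-lam * (t - t₀))) t := by
    intro t
    have h0 : HasDerivAt (fun t => t - t₀) 1 t := (hasDerivAt_id t).sub_const t₀
    have h := (h0.const_mul a).add ((h0.const_mul (-lam)).exp.const_mul (B / lam))
    refine HasDerivAt.congr_deriv h ?_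
    field_simp
    ring
  have hanti := antitoneOn_of_hasDerivWithinAt (convex_Ici t₀)
    (fun t ht => (hW t ht).mul (hφ' t).exp.hasDerivWithinAt) (fun t ht => by
      have := mul_le_mul_of_nonneg_right (hle t ht) (Real.exp_pos (φ t)).le
      linarith)
  have h := hanti (self_mem_Ici) (mem_Ici.2 ht) ht
  have h0 : φ t₀ = B / lam := by simp [hφ]
  have h1 : a * (t - t₀) ≤ φ t := by
    have : 0 ≤ B / lam * Real.exp (-lam * (t - t₀)) := by positivity
    linarith
  have h2 : W t * Real.exp (a * (t - t₀)) ≤ W t₀ * Real.exp (B / lam) := by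
    rw [← h0]
    exact (mul_le_mul_of_nonneg_left (Real.exp_le_exp.2 h1) (hW0 t ht)).trans h
  calc W t = W t * Real.exp (a * (t - t₀)) * Real.exp (-a * (t - t₀)) := by
        rw [mul_assoc, ← Real.exp_add]; simp
    _ ≤ W t₀ * Real.exp (B / lam) * Real.exp (-a * (t - t₀)) := by gcongr
    _ = _ := by ring

/-! ### Assembling the cascade -/

section Trajectory

variable {C : Vec m} {μ γ η kP : ℝ} {q : ℝ → Vec m} {x : ℝ → State m} {s : Set ℝ}

lemma IsTrajectoryOn.parameter (h : IsTrajectoryOn C μ γ η kP q x s) :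
    ∀ t ∈ s, HasDerivWithinAt (fun t => (x t).1) (γ • f (q t) (x t).1) s t := fun t ht =>
  (ContinuousLinearMap.fst ℝ (Vec m) (Vec m × ℝ)).hasFDerivAt.comp_hasDerivWithinAt t (h t ht)

lemma IsTrajectoryOn.snd (h : IsTrajectoryOn C μ γ η kP q x s) :
    ∀ t ∈ s, HasDerivWithinAt (fun t => (x t).2)
      (η • g₁ μ (x t).2.1 (x t).2.2 (C + (x t).1), kP * g₂ C (x t).2.1) s t := fun t ht =>
  (ContinuousLinearMap.snd ℝ (Vec m) (Vec m × ℝ)).hasFDerivAt.comp_hasDerivWithinAt t (h t ht)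

lemma IsTrajectoryOn.velocity (h : IsTrajectoryOn C μ γ η kP q x s) :
    ∀ t ∈ s, HasDerivWithinAt (fun t => (x t).2.1)
      (η • g₁ μ (x t).2.1 (x t).2.2 (C + (x t).1)) s t := fun t ht =>
  (ContinuousLinearMap.fst ℝ (Vec m) ℝ).hasFDerivAt.comp_hasDerivWithinAt t (h.snd t ht)

lemma IsTrajectoryOn.reachingError (h : IsTrajectoryOn C μ γ η kP q x s) :
    ∀ t ∈ s, HasDerivWithinAt (fun t => (x t).2.2) (kP * g₂ C (x t).2.1) s t := fun t ht =>
  (ContinuousLinearMap.snd ℝ (Vec m) ℝ).hasFDerivAt.comp_hasDerivWithinAt t (h.snd t ht)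

lemma positivelyInvariant_OmegaC (hγ : 0 < γ) :
    PositivelyInvariant C μ γ η kP q (OmegaC C μ) := fun _ _ _ _ hx h0 _ ht =>
  (antitoneOn_norm_parameter hγ (convex_Icc _ _) hx.parameter
    (left_mem_Icc.2 (ht.1.trans ht.2)) ht ht.1).trans h0

/-- Exponential stability, uniform over persistently exciting signals, of the trajectories whose
initial parameter error is at most `μ`. -/
lemma exists_exp_decay (hC : C ≠ 0) (hμ : 0 < μ) (hγ : 0 < γ) (hη : 0 < η) (hk : 0 < kP)
    {α₀ α₁ T : ℝ} (hα : 0 < α₀) (hT : 0 < T) :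
    ∃ K : ℝ, 0 < K ∧ ∃ lam : ℝ, 0 < lam ∧ ∀ q : ℝ → Vec m, PersistentlyExciting α₀ α₁ T q →
      ∀ t₀ : ℝ, 0 ≤ t₀ → ∀ x : ℝ → State m,
        IsTrajectoryOn C μ γ η kP q x (Ici t₀) → ‖(x t₀).1‖ ≤ μ →
          ∀ t : ℝ, t₀ ≤ t → ‖x t‖ ≤ K * Real.exp (-lam * (t - t₀)) * ‖x t₀‖ := by
  obtain ⟨K₁, hK₁, l₁, hl₁, hz⟩ := exists_exp_decay_parameter (m := m) (α₁ := α₁) hγ hα hT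
  obtain ⟨δ, k₁, k₂, a, b, hk₁, hk₂, ha, hb, hlow, hupp, hder⟩ := exists_lyap hC hμ hη hk
  set B := b * (K₁ * μ) with hB
  have hB0 : 0 < B := by positivity
  set R := 2 * k₂ / k₁ * Real.exp (B / l₁) with hR
  have hR0 : 0 < R := by positivity
  -- `√R` and `a / 2` arise because the Lyapunov function bounds squares; the 2 in `R` comes from
  -- bounding `‖u‖² + e²` by the max norm.
  refine ⟨max K₁ (√R), lt_max_of_lt_left hK₁, min l₁ (a / 2), lt_min hl₁ (half_pos ha), ?_⟩
  intro q hq t₀ ht₀ x hx h0 t ht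
  have hzx := hz q hq t₀ ht₀ _ hx.parameter
  have hanti := antitoneOn_norm_parameter hγ (convex_Ici t₀) hx.parameter
  have hnn : ∀ (u : Vec m) (e : ℝ), 0 ≤ lyap C η kP δ u e := fun u e =>
    le_trans (by positivity) (hlow u e)
  have hW := gronwall_exp_perturbation (a := a) hB0.le hl₁
    (fun τ hτ => hasDerivWithinAt_lyap (δ := δ) hη hk (z := fun t => (x t).1)
      (hx.velocity τ hτ) (hx.reachingError τ hτ))
    (fun τ _ => hnn _ _) (fun τ hτ => by
      have h1 : ‖(x τ).1‖ ≤ μ := (hanti self_mem_Ici hτ hτ).trans h0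
      refine (hder _ _ _ h1).trans (mul_le_mul_of_nonneg_right ?_ (hnn _ _))
      have h2 : ‖(x τ).1‖ ≤ K₁ * Real.exp (-l₁ * (τ - t₀)) * μ :=
        (hzx τ hτ).trans (mul_le_mul_of_nonneg_left h0 (by positivity))
      have := mul_le_mul_of_nonneg_left h2 hb.le
      rw [hB]
      linarith) ht
  have hn1 : ‖(x t₀).2.1‖ ≤ ‖x t₀‖ := (norm_fst_le _).trans (norm_snd_le _)
  have hn2 : |(x t₀).2.2| ≤ ‖x t₀‖ := (norm_snd_le (x t₀).2).trans (norm_snd_le _)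
  have hN0 : ‖(x t₀).2.1‖ ^ 2 + (x t₀).2.2 ^ 2 ≤ 2 * ‖x t₀‖ ^ 2 := by
    have h1 := pow_le_pow_left₀ (norm_nonneg _) hn1 2
    have h2 := pow_le_pow_left₀ (abs_nonneg _) hn2 2
    rw [sq_abs] at h2
    linarith
  have hN : ‖(x t).2.1‖ ^ 2 + (x t).2.2 ^ 2 ≤
      (√R * Real.exp (-(a / 2) * (t - t₀)) * ‖x t₀‖) ^ 2 := by
    have h1 : k₁ * (‖(x t).2.1‖ ^ 2 + (x t).2.2 ^ 2) ≤
        Real.exp (B / l₁) * Real.exp (-a * (t - t₀)) * (k₂ * (2 * ‖x t₀‖ ^ 2)) :=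
      (hlow _ _).trans (hW.trans (mul_le_mul_of_nonneg_left
        ((hupp _ _).trans (mul_le_mul_of_nonneg_left hN0 hk₂.le)) (by positivity)))
    rw [mul_comm, ← le_div_iff₀ hk₁] at h1
    refine h1.trans_eq ?_
    rw [mul_pow, mul_pow, Real.sq_sqrt hR0.le, ← Real.exp_nat_mul, hR]
    have : ((2 : ℕ) : ℝ) * (-(a / 2) * (t - t₀)) = -a * (t - t₀) := by push_cast; ring
    rw [this]
    ring
  have hsub : 0 ≤ t - t₀ := by linarith
  have hdom : √R * Real.exp (-(a / 2) * (t - t₀)) * ‖x t₀‖ ≤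
      max K₁ (√R) * Real.exp (-min l₁ (a / 2) * (t - t₀)) * ‖x t₀‖ := by
    gcongr
    · exact le_max_right _ _
    · exact min_le_right _ _
  have hpos : 0 ≤ √R * Real.exp (-(a / 2) * (t - t₀)) * ‖x t₀‖ := by positivity
  rw [norm_prod_le_iff, norm_prod_le_iff]
  refine ⟨?_, ?_, ?_⟩
  · calc ‖(x t).1‖ ≤ K₁ * Real.exp (-l₁ * (t - t₀)) * ‖(x t₀).1‖ := hzx t ht
      _ ≤ max K₁ (√R) * Real.exp (-min l₁ (a / 2) * (t - t₀)) * ‖x t₀‖ := by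
        gcongr
        · exact le_max_left _ _
        · exact min_le_left _ _
        · exact norm_fst_le _
  · refine le_trans ?_ hdom
    exact (sq_le_sq₀ (norm_nonneg _) hpos).1 (by linarith [sq_nonneg (x t).2.2])
  · refine le_trans ?_ hdom
    rw [Real.norm_eq_abs]
    refine (sq_le_sq₀ (abs_nonneg _) hpos).1 ?_
    rw [sq_abs]
    linarith [sq_nonneg ‖(x t).2.1‖]

end Trajectory

end HML

theorem theorem1 (m : ℕ) (C : HML.Vec m) (hC : C ≠ 0) (μ : ℝ) (hμ : 0 < μ)
    (α₀ α₁ T : ℝ) :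
    ∃ εstar : ℝ, 0 < εstar ∧
      ∀ γ η kP : ℝ, 0 < γ → 0 < η → 0 < kP → γ ^ 2 / (η * kP) ∈ Set.Ioo 0 εstar →
        (∀ δq : ℝ → HML.Vec m, HML.PersistentlyExciting α₀ α₁ T δq →
          HML.PositivelyInvariant C μ γ η kP δq (HML.OmegaC C μ)) ∧
        ∃ K : ℝ, 0 < K ∧ ∃ lam : ℝ, 0 < lam ∧
          ∀ δq : ℝ → HML.Vec m, HML.PersistentlyExciting α₀ α₁ T δq →
            ∀ t₀ : ℝ, 0 ≤ t₀ → ∀ x : ℝ → HML.State m,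
              HML.IsTrajectoryOn C μ γ η kP δq x (Set.Ici t₀) → x t₀ ∈ HML.OmegaC C μ →
                ∀ t : ℝ, t₀ ≤ t → ‖x t‖ ≤ K * Real.exp (-lam * (t - t₀)) * ‖x t₀‖ := by
  -- The estimate is proved for each fixed choice of gains, with `K` and `lam` depending on them; 1
  -- is an arbitrary threshold.
  refine ⟨1, one_pos, fun γ η kP hγ hη hk _ =>
    ⟨fun q _ => HML.positivelyInvariant_OmegaC hγ, ?_⟩⟩
  by_cases h : 0 < α₀ ∧ 0 < T
  · obtain ⟨K, hK, lam, hlam, hdecay⟩ :=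
      HML.exists_exp_decay (α₁ := α₁) hC hμ hγ hη hk h.1 h.2
    exact ⟨K, hK, lam, hlam, fun q hq t₀ ht₀ x hx h0 =>
      hdecay q hq t₀ ht₀ x hx (le_trans h0 (min_le_left _ _))⟩
  -- Without `0 < α₀` and `0 < T` no signal is persistently exciting.
  · exact ⟨1, one_pos, 1, one_pos, fun q hq => absurd ⟨hq.2.2.1, hq.2.1⟩ h⟩
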